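/- Let $\rho:\mathbb R\to(0,\infty)$ be an admissible weight function, i.e. $\rho$ is measurable and there are constants $C\ge 1$, $\omega\in\mathbb R$ with $\rho(\tau)\le Ce^{\omega t}\rho(\tau+t)$ for all $\tau\in\mathbb R$, $t>0$. Let $$C_0^\rho(\mathbb R)=\Bigl\{u:\mathbb R\to\mathbb R \;:\; u \text{ continuous},\ \lim_{x\to\pm\infty}u(x)\rho(x)=0\Bigr\},\qquad \|u\|=\sup_{x\in\mathbb R}|u(x)|\rho(x),$$ and let $\mathcal T=(T_t)_{t\ge0}$, $T_tf(x)=f(x+t)$, be the translation semigroup on $C_0^\rho(\mathbb R)$. The semigroup $\mathcal T$ is called frequently hypercyclic if there is $f\in C_0^\rho(\mathbb R)$ such that $\liminf_{N\to\infty}\mu(\{t\in[0,N]:T_tf\in U\})/N>0$ for every non-empty open $U\subseteq C_0^\rho(\mathbb R)$, where $\mu$ is Lebesgue measure. For $A\subseteq\mathbb N$ put $\underline{\mathrm{dens}}(A)=\liminf_{N\to\infty}\#\{n\le N:n\in A\}/N$, and write $[\![-p,p]\!]=\{-p,-p+1,\dots,p\}$. Assume that $\sup_{k\in\mathbb Z}\rho(k+1)/\rho(k)<\infty$.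 Then $\mathcal T$ is frequently hypercyclic on $C_0^\rho(\mathbb R)$ if and only if there exist a sequence $(M(p))_{p\ge1}$ of positive real numbers tending to $\infty$ and a sequence $(E_p)_{p\ge1}$ of subsets of $\mathbb N$ such that: (a) for any $p\ge1$, $\underline{\mathrm{dens}}(E_p)>0$; (b) for any distinct $p,q\ge1$, $(E_p+[\![-p,p]\!])\cap(E_q+[\![-q,q]\!])=\emptyset$; (c) for any $p\ge1$, $\lim_{n\to\infty,\ n\in E_p}\rho(n)=0$; (d) for any $p,q\ge1$ and any $n\in E_p$, $m\in E_q$ with $m\ne n$, $\rho(m-n)\le \dfrac{1}{M(p)M(q)}$. Moreover, $\mathcal T$ is frequently hypercyclic on $C_0^\rho(\mathbb R)$ if and only if for every sequence $(M(p))_{p\ge1}$ of positive real numbers tending to $\infty$ there exists a sequence $(E_p)_{p\ge1}$ of subsets of $\mathbb N$ such that (a)-(d) hold. -/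

import Mathlib

open Set Filter Topology MeasureTheory
open scoped NNReal ENNReal Pointwise

noncomputable section

/-- The lower density `liminf_{N → ∞} #{n ≤ N : n ∈ A} / N` of a set of natural numbers. -/
def lowerDensityNat (A : Set ℕ) : ℝ :=
  liminf (fun N : ℕ => (({n : ℕ | n ≤ N ∧ n ∈ A}.ncard : ℕ) : ℝ) / (N : ℝ)) atTop

/-- The lower density `liminf_{N → ∞} μ(S ∩ [0, N]) / N` of a set of nonnegative reals, where `μ`
is Lebesgue measure and `N` runs through the reals. -/
def lowerDensityReal (S : Set ℝ≥0) : ℝ≥0∞ :=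
  liminf (fun N : ℝ => volume (((↑) : ℝ≥0 → ℝ) '' S ∩ Icc 0 N) / ENNReal.ofReal N) atTop

/-- Frequent hypercyclicity of a one-parameter family `(T t)_{t ≥ 0}` of continuous linear
operators. -/
def FrequentlyHypercyclic {X : Type*} [NormedAddCommGroup X] [NormedSpace ℝ X]
    (T : ℝ≥0 → X →L[ℝ] X) : Prop :=
  ∃ x : X, ∀ U : Set X, IsOpen U → U.Nonempty → 0 < lowerDensityReal {t : ℝ≥0 | T t x ∈ U}

/-- Admissible weight functions on the real line. -/
structure IsAdmissibleWeight (ρ : ℝ → ℝ) : Prop where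
  measurable : Measurable ρ
  pos : ∀ x, 0 < ρ x
  growth : ∃ M ω : ℝ, 1 ≤ M ∧ ∀ τ t : ℝ, 0 < t → ρ τ ≤ M * Real.exp (ω * t) * ρ (τ + t)

/-- An admissible weight is bounded on bounded intervals. -/
theorem IsAdmissibleWeight.exists_bound {ρ : ℝ → ℝ} (hρ : IsAdmissibleWeight ρ) (R : ℝ) :
    ∃ C : ℝ, ∀ x ∈ Icc (-R) R, ρ x ≤ C := by
  obtain ⟨M, ω, hM, h⟩ := hρ.growth
  refine ⟨M * Real.exp (|ω| * (2 * R + 1)) * ρ (R + 1), fun x hx => ?_⟩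
  have h1 := h x (R + 1 - x) (by linarith [hx.2])
  rw [add_sub_cancel] at h1
  refine h1.trans ?_
  have h2 : ω * (R + 1 - x) ≤ |ω| * (2 * R + 1) := by
    have h3 : 0 ≤ R + 1 - x := by linarith [hx.2]
    have h4 : R + 1 - x ≤ 2 * R + 1 := by linarith [hx.1]
    exact (mul_le_mul_of_nonneg_right (le_abs_self ω) h3).trans
      (mul_le_mul_of_nonneg_left h4 (abs_nonneg ω))
  have := hρ.pos (R + 1)
  gcongr

/-- The linear space of continuous functions `u : ℝ → ℝ` such that `u x * ρ x → 0` as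
`x → ± ∞`. -/
def c0Submodule (ρ : ℝ → ℝ) : Submodule ℝ (ℝ → ℝ) where
  carrier := {u | Continuous u ∧ Tendsto (fun x => u x * ρ x) atTop (𝓝 0) ∧
    Tendsto (fun x => u x * ρ x) atBot (𝓝 0)}
  zero_mem' := by
    refine ⟨continuous_const, ?_, ?_⟩ <;> simp
  add_mem' := by
    rintro u v ⟨hu, hu1, hu2⟩ ⟨hv, hv1, hv2⟩
    refine ⟨hu.add hv, ?_, ?_⟩
    · simpa [add_mul] using hu1.add hv1
    · simpa [add_mul] using hu2.add hv2
  smul_mem' := by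
    rintro c u ⟨hu, hu1, hu2⟩
    refine ⟨hu.const_smul c, ?_, ?_⟩
    · simpa [mul_assoc] using hu1.const_mul c
    · simpa [mul_assoc] using hu2.const_mul c

/-- The space `C₀^ρ(ℝ)`. It is a type of its own, so that it carries only the weighted supremum
norm defined below and no topology inherited from the space of all functions. -/
def C0Weighted {ρ : ℝ → ℝ} (_hρ : IsAdmissibleWeight ρ) : Type := ↥(c0Submodule ρ)

namespace C0Weighted

variable {ρ : ℝ → ℝ} {hρ : IsAdmissibleWeight ρ}

instance : AddCommGroup (C0Weighted hρ) := inferInstanceAs (AddCommGroup ↥(c0Submodule ρ))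

instance : Module ℝ (C0Weighted hρ) := inferInstanceAs (Module ℝ ↥(c0Submodule ρ))

instance : FunLike (C0Weighted hρ) ℝ ℝ where
  coe := Subtype.val (p := fun u : ℝ → ℝ => u ∈ c0Submodule ρ)
  coe_injective := Subtype.val_injective

/-- The element of `C₀^ρ(ℝ)` given by a function in `c0Submodule ρ`. -/
def mk (hρ : IsAdmissibleWeight ρ) (u : ℝ → ℝ) (hu : u ∈ c0Submodule ρ) : C0Weighted hρ :=
  (⟨u, hu⟩ : ↥(c0Submodule ρ))

theorem mk_apply (u : ℝ → ℝ) (hu : u ∈ c0Submodule ρ) (x : ℝ) : mk hρ u hu x = u x := rfl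

theorem coe_mem (u : C0Weighted hρ) : (u : ℝ → ℝ) ∈ c0Submodule ρ :=
  Subtype.property (p := fun u : ℝ → ℝ => u ∈ c0Submodule ρ) u

theorem bddAbove (u : C0Weighted hρ) : BddAbove (range fun x : ℝ => |u x| * ρ x) := by
  obtain ⟨hc, h1, h2⟩ := u.coe_mem
  have e1 := h1.eventually (Metric.ball_mem_nhds (0 : ℝ) one_pos)
  have e2 := h2.eventually (Metric.ball_mem_nhds (0 : ℝ) one_pos)
  obtain ⟨a, ha⟩ := eventually_atTop.1 e1
  obtain ⟨b, hb⟩ := eventually_atBot.1 e2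
  obtain ⟨C, hC⟩ := hρ.exists_bound (max |a| |b|)
  obtain ⟨K, hK⟩ := (isCompact_Icc (a := -(max |a| |b|)) (b := max |a| |b|)).exists_bound_of_continuousOn
    hc.continuousOn
  have key : ∀ x, dist (u x * ρ x) 0 < 1 → |u x| * ρ x ≤ 1 := fun x hx => by
    rw [dist_zero_right, Real.norm_eq_abs, abs_mul, abs_of_pos (hρ.pos x)] at hx
    exact hx.le
  refine ⟨max 1 (K * C), ?_⟩
  rintro _ ⟨x, rfl⟩
  by_cases hxa : a ≤ x
  · exact (key x (ha x hxa)).trans (le_max_left _ _)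
  by_cases hxb : x ≤ b
  · exact (key x (hb x hxb)).trans (le_max_left _ _)
  have hx : x ∈ Icc (-(max |a| |b|)) (max |a| |b|) := by
    push Not at hxa hxb
    constructor
    · linarith [neg_abs_le b, le_max_right |a| |b|]
    · linarith [le_abs_self a, le_max_left |a| |b|]
  refine le_trans ?_ (le_max_right _ _)
  have hKx := hK x hx
  rw [Real.norm_eq_abs] at hKx
  exact mul_le_mul hKx (hC x hx) (hρ.pos x).le ((abs_nonneg _).trans hKx)

/-- The weighted supremum norm `sup_x |u x| ρ x`. -/
def supNorm (u : C0Weighted hρ) : ℝ := ⨆ x : ℝ, |u x| * ρ x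

theorem le_supNorm (u : C0Weighted hρ) (x : ℝ) : |u x| * ρ x ≤ supNorm u :=
  le_ciSup (bddAbove u) x

theorem supNorm_nonneg (u : C0Weighted hρ) : 0 ≤ supNorm u :=
  (mul_nonneg (abs_nonneg _) (hρ.pos 0).le).trans (le_supNorm u 0)

instance : NormedAddCommGroup (C0Weighted hρ) :=
  AddGroupNorm.toNormedAddCommGroup
    { toFun := supNorm
      map_zero' := by
        have h : ∀ x : ℝ, |(0 : C0Weighted hρ) x| * ρ x = 0 := fun x => by
          have : (0 : C0Weighted hρ) x = 0 := rfl
          rw [this, abs_zero, zero_mul]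
        simp only [supNorm, h, ciSup_const]
      add_le' := fun u v => ciSup_le fun x => by
        have h : (u + v : C0Weighted hρ) x = u x + v x := rfl
        have h1 := mul_le_mul_of_nonneg_right (abs_add_le (u x) (v x)) (hρ.pos x).le
        rw [h]
        linarith [le_supNorm u x, le_supNorm v x]
      neg' := fun u => by
        have h : ∀ x : ℝ, |(-u : C0Weighted hρ) x| = |u x| := fun x => abs_neg (u x)
        simp only [supNorm, h]
      eq_zero_of_map_eq_zero' := fun u hu => DFunLike.ext _ _ fun x => by
        have h1 := le_supNorm u x
        have h2 : |u x| * ρ x ≤ 0 := h1.trans (le_of_eq hu)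
        have h3 : |u x| ≤ 0 := nonpos_of_mul_nonpos_left h2 (hρ.pos x)
        exact abs_nonpos_iff.1 h3 }

theorem norm_def (u : C0Weighted hρ) : ‖u‖ = ⨆ x : ℝ, |u x| * ρ x := rfl

instance : NormedSpace ℝ (C0Weighted hρ) where
  norm_smul_le c u := by
    refine ciSup_le fun x => ?_
    have h : (c • u : C0Weighted hρ) x = c * u x := rfl
    rw [h, abs_mul, mul_assoc, Real.norm_eq_abs]
    exact mul_le_mul_of_nonneg_left (le_supNorm u x) (abs_nonneg c)

theorem exists_shift_bound (hρ : IsAdmissibleWeight ρ) (t : ℝ≥0) :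
    ∃ C : ℝ, 0 ≤ C ∧ ∀ x : ℝ, ρ x ≤ C * ρ (x + t) := by
  obtain ⟨M, ω, hM, h⟩ := hρ.growth
  rcases eq_or_lt_of_le t.2 with ht | ht
  · exact ⟨1, zero_le_one, fun x => by
      have : (t : ℝ) = 0 := ht.symm
      simp [this]⟩
  · exact ⟨M * Real.exp (ω * t), by positivity, fun x => h x t ht⟩

theorem translate_mem (t : ℝ≥0) (u : C0Weighted hρ) :
    (fun x : ℝ => u (x + t)) ∈ c0Submodule ρ := by
  obtain ⟨hc, h1, h2⟩ := u.coe_mem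
  obtain ⟨C, hC0, hC⟩ := exists_shift_bound hρ t
  have key : ∀ l : Filter ℝ, Tendsto (fun x : ℝ => u (x + t) * ρ (x + t)) l (𝓝 0) →
      Tendsto (fun x : ℝ => u (x + t) * ρ x) l (𝓝 0) := fun l hl => by
    refine squeeze_zero_norm (fun x => ?_) 
      (by simpa only [norm_zero, mul_zero] using hl.norm.const_mul C)
    rw [norm_mul, norm_mul, Real.norm_of_nonneg (hρ.pos x).le,
      Real.norm_of_nonneg (hρ.pos (x + t)).le]
    calc ‖u (x + t)‖ * ρ x ≤ ‖u (x + t)‖ * (C * ρ (x + t)) :=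
          mul_le_mul_of_nonneg_left (hC x) (norm_nonneg _)
      _ = C * (‖u (x + t)‖ * ρ (x + t)) := by ring
  exact ⟨hc.comp (continuous_id.add continuous_const),
    key _ (h1.comp (tendsto_atTop_add_const_right _ _ tendsto_id)),
    key _ (h2.comp (tendsto_atBot_add_const_right _ _ tendsto_id))⟩

/-- The translation semigroup on `C₀^ρ(ℝ)`: `(T_t u)(x) = u (x + t)`. -/
def translation (hρ : IsAdmissibleWeight ρ) (t : ℝ≥0) : C0Weighted hρ →L[ℝ] C0Weighted hρ :=
  LinearMap.mkContinuousOfExistsBound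
    { toFun := fun u => mk hρ (fun x : ℝ => u (x + t)) (translate_mem t u)
      map_add' := fun _ _ => rfl
      map_smul' := fun _ _ => rfl }
    (by
      obtain ⟨C, hC0, hC⟩ := exists_shift_bound hρ t
      refine ⟨C, fun u => ciSup_le fun x => ?_⟩
      calc |u (x + t)| * ρ x ≤ |u (x + t)| * (C * ρ (x + t)) :=
            mul_le_mul_of_nonneg_left (hC x) (abs_nonneg _)
        _ = C * (|u (x + t)| * ρ (x + t)) := by ring
        _ ≤ C * ‖u‖ := mul_le_mul_of_nonneg_left (le_supNorm u (x + t)) hC0)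

theorem translation_apply (t : ℝ≥0) (u : C0Weighted hρ) (x : ℝ) :
    translation hρ t u x = u (x + t) := rfl

end C0Weighted

/-- Conditions (a)-(d) on a sequence `(M p)_{p ≥ 1}` of numbers and a sequence `(E p)_{p ≥ 1}` of
sets of natural numbers; the values at `p = 0` play no role. -/
structure DensityConditions (ρ : ℝ → ℝ) (M : ℕ → ℝ) (E : ℕ → Set ℕ) : Prop where
  pos_density : ∀ p, 1 ≤ p → 0 < lowerDensityNat (E p)
  disjoint : ∀ p q : ℕ, 1 ≤ p → 1 ≤ q → p ≠ q →
    Disjoint (((↑) : ℕ → ℤ) '' E p + Icc (-(p : ℤ)) p) (((↑) : ℕ → ℤ) '' E q + Icc (-(q : ℤ)) q)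
  tendsto_zero : ∀ p, 1 ≤ p → Tendsto (fun n : ℕ => ρ n) (atTop ⊓ 𝓟 (E p)) (𝓝 0)
  le_inv : ∀ p q : ℕ, 1 ≤ p → 1 ≤ q → ∀ n ∈ E p, ∀ m ∈ E q, m ≠ n →
    ρ ((m : ℝ) - (n : ℝ)) ≤ 1 / (M p * M q)

end

/-! Admissibility bounds `ρ` by its values to the right, and the hypothesis on `ρ (k + 1) / ρ k`
gives the other direction. Hence `ρ x ≤ D * ρ y` whenever `|x - y| ≤ 1`, and real and integer times
are interchangeable up to constants.

Necessity (`FrequentlyHypercyclic.exists_densityConditions`), for any positive `M`: let `f` visit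
small balls around tents of rapidly growing height `a p`. A visit at time `t` forces a peak of `f`
at `t`, of a height that identifies `p`, with `|f| < 1` elsewhere nearby. So visits for different
`p` are far apart, which gives (b). Since `f * ρ → 0` while `f ≥ 1` at visits, (c) follows.
Comparing a visit at `t` with the peak at another visit `s` gives (d).

Sufficiency (`DensityConditions.frequentlyHypercyclic`): choose `φ k` with `M (φ k)` huge compared
with the `k`-th function `g k` of a dense sequence, and glue the translates of `g k` to the points
of `E (φ k)`. The supports are disjoint and the norm is a supremum, so at each point the error of an
approximation comes from a single other translate, and (d) bounds it. Membership in the space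
follows from (c) for finitely many `k` and from (d) for the rest.

Necessity holds for every `M` and sufficiency needs only one, so both equivalences follow. -/

/-! ### Comparison of nearby values of the weight -/

theorem IsAdmissibleWeight.exists_comparison {ρ : ℝ → ℝ} (hρ : IsAdmissibleWeight ρ)
    (hsup : BddAbove (Set.range fun k : ℤ => ρ ((k : ℝ) + 1) / ρ (k : ℝ))) :
    ∃ D : ℝ, 1 ≤ D ∧ ∀ x y : ℝ, |x - y| ≤ 1 → ρ x ≤ D * ρ y := by
  obtain ⟨M, ω, hM, h⟩ := hρ.growth
  obtain ⟨K', hK'⟩ := hsup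
  set K := max K' 1
  have hK1 : 1 ≤ K := le_max_right _ _
  have hK : ∀ k : ℤ, ρ ((k : ℝ) + 1) ≤ K * ρ k := fun k => by
    have h1 : ρ ((k : ℝ) + 1) / ρ k ≤ K := (hK' ⟨k, rfl⟩).trans (le_max_left _ _)
    rwa [div_le_iff₀ (hρ.pos _)] at h1
  set A := M * Real.exp (|ω| * 2)
  have hA1 : 1 ≤ A := one_le_mul_of_one_le_of_one_le hM (Real.one_le_exp (by positivity))
  have hA : ∀ x y : ℝ, x ≤ y → y ≤ x + 2 → ρ x ≤ A * ρ y := by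
    intro x y hxy hyx
    rcases hxy.eq_or_lt with rfl | hlt
    · exact le_mul_of_one_le_left (hρ.pos _).le hA1
    · have h1 := h x (y - x) (by linarith)
      rw [add_sub_cancel] at h1
      refine h1.trans (mul_le_mul_of_nonneg_right ?_ (hρ.pos _).le)
      refine mul_le_mul_of_nonneg_left (Real.exp_le_exp.2 ?_) (by linarith)
      exact (mul_le_mul_of_nonneg_right (le_abs_self ω) (by linarith)).trans
        (mul_le_mul_of_nonneg_left (by linarith) (abs_nonneg ω))
  have hAK : A ≤ A * (K * (K * A)) :=
    le_mul_of_one_le_right (by linarith)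
      (one_le_mul_of_one_le_of_one_le hK1 (one_le_mul_of_one_le_of_one_le hK1 hA1))
  refine ⟨A * (K * (K * A)), hA1.trans hAK, fun x y hxy => ?_⟩
  rw [abs_le] at hxy
  rcases le_total x y with hle | hle
  · exact (hA x y hle (by linarith)).trans (mul_le_mul_of_nonneg_right hAK (hρ.pos _).le)
  -- Leftward comparison: from `x` go right to `j + 2`, down two integers by the bound on quotients,
  -- then right from `j` to `y`.
  · have h1 := Int.floor_le y
    have h2 := Int.lt_floor_add_one y
    set j := ⌊y⌋
    have e1 : ρ x ≤ A * ρ ((j : ℝ) + 1 + 1) := hA _ _ (by linarith) (by linarith)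
    have e2 := hK (j + 1)
    have e3 := hK j
    have e4 : ρ j ≤ A * ρ y := hA _ _ h1 (by linarith)
    push_cast at e2
    calc ρ x ≤ A * ρ ((j : ℝ) + 1 + 1) := e1
      _ ≤ A * (K * (K * (A * ρ y))) := by gcongr; exact e2.trans (by gcongr; exact e3.trans (by gcongr))
      _ = A * (K * (K * A)) * ρ y := by ring

theorem le_pow_mul_of_comparison {ρ : ℝ → ℝ} {D : ℝ} (hD : 1 ≤ D)
    (h : ∀ x y : ℝ, |x - y| ≤ 1 → ρ x ≤ D * ρ y) (n : ℕ) :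
    ∀ x y : ℝ, |x - y| ≤ n → ρ x ≤ D ^ n * ρ y := by
  induction n with
  | zero =>
    intro x y hxy
    have : x = y := by
      rw [Nat.cast_zero] at hxy
      exact sub_eq_zero.1 (abs_nonpos_iff.1 hxy)
    simp [this]
  | succ n ih =>
    intro x y hxy
    have hn : (0 : ℝ) < n + 1 := by positivity
    push_cast at hxy
    set w := (x - y) / (n + 1)
    have hw : |w| ≤ 1 := by
      rw [abs_div, abs_of_pos hn, div_le_one hn]; exact hxy
    have hwx : x - y = n * w + w := by
      simp only [w]; field_simp
    have e1 := h x (x - w) (by rwa [sub_sub_cancel])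
    have e2 := ih (x - w) y (by
      rw [show x - w - y = n * w by linarith, abs_mul, Nat.abs_cast]
      exact mul_le_of_le_one_right (Nat.cast_nonneg n) hw)
    calc ρ x ≤ D * ρ (x - w) := e1
      _ ≤ D * (D ^ n * ρ y) := by gcongr
      _ = D ^ (n + 1) * ρ y := by ring

theorem div_pow_le_of_comparison {ρ : ℝ → ℝ} {D : ℝ} (hD : 1 ≤ D)
    (h : ∀ x y : ℝ, |x - y| ≤ 1 → ρ x ≤ D * ρ y) (n : ℕ) (x : ℝ) (hx : |x| ≤ n) :
    ρ 0 / D ^ n ≤ ρ x := by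
  rw [div_le_iff₀ (by positivity), mul_comm]
  exact le_pow_mul_of_comparison hD h n 0 x (by rwa [zero_sub, abs_neg])

/-! ### Lower densities of sets of integers and of times -/

theorem ncard_le_add_one (A : Set ℕ) (N : ℕ) : {n : ℕ | n ≤ N ∧ n ∈ A}.ncard ≤ N + 1 := by
  calc {n : ℕ | n ≤ N ∧ n ∈ A}.ncard ≤ (Iic N).ncard :=
        ncard_le_ncard (fun n hn => hn.1) (finite_Iic N)
    _ = N + 1 := by
      rw [← Finset.coe_Iic, ncard_coe_finset, Nat.card_Iic]

theorem exists_of_lowerDensityNat_pos {A : Set ℕ} (hA : 0 < lowerDensityNat A) :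
    ∃ c : ℝ, 0 < c ∧ ∀ᶠ N : ℕ in atTop, c * N ≤ {n : ℕ | n ≤ N ∧ n ∈ A}.ncard := by
  obtain ⟨c, hc0, hc⟩ := exists_between hA
  have h := eventually_lt_of_lt_liminf hc (isBoundedUnder_of ⟨0, fun N => by positivity⟩)
  refine ⟨c, hc0, ?_⟩
  filter_upwards [h, eventually_gt_atTop 0] with N hN hN0
  exact ((lt_div_iff₀ (by exact_mod_cast hN0)).1 hN).le

theorem lowerDensityNat_pos {A : Set ℕ} {c : ℝ} (hc : 0 < c)
    (h : ∀ᶠ N : ℕ in atTop, c * N ≤ {n : ℕ | n ≤ N ∧ n ∈ A}.ncard) :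
    0 < lowerDensityNat A := by
  refine hc.trans_le (le_liminf_of_le ?_ ?_)
  -- A real `liminf` is meaningful only for bounded quotients; here `(N + 1) / N ≤ 2`.
  · refine IsBoundedUnder.isCoboundedUnder_ge ⟨2, ?_⟩
    rw [eventually_map]
    filter_upwards [eventually_gt_atTop 0] with N hN
    have hN' : (1 : ℝ) ≤ N := by exact_mod_cast hN
    have h1 : (({n : ℕ | n ≤ N ∧ n ∈ A}.ncard : ℕ) : ℝ) ≤ N + 1 := by
      exact_mod_cast ncard_le_add_one A N
    rw [div_le_iff₀ (by linarith)]
    linarith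
  · filter_upwards [h, eventually_gt_atTop 0] with N hN hN0
    rwa [le_div_iff₀ (by exact_mod_cast hN0)]

theorem nonempty_of_lowerDensityNat_pos {A : Set ℕ} (hA : 0 < lowerDensityNat A) : A.Nonempty := by
  rw [nonempty_iff_ne_empty]
  rintro rfl
  obtain ⟨c, hc, h⟩ := exists_of_lowerDensityNat_pos hA
  obtain ⟨N, hN, hN0⟩ := (h.and (eventually_gt_atTop 0)).exists
  have : (0 : ℝ) < c * N := mul_pos hc (by exact_mod_cast hN0)
  simp at hN
  linarith

/-- A set of times that contains short intervals to the right of the points of a set of positive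
lower density has positive lower density. -/
theorem lowerDensityReal_pos {A : Set ℕ} (hA : 0 < lowerDensityNat A) {S : Set ℝ≥0} {η : ℝ}
    (hη : 0 < η) (hη1 : η ≤ 1)
    (hS : ∀ n ∈ A, ∀ t : ℝ≥0, (n : ℝ) ≤ t → (t : ℝ) < n + η → t ∈ S) :
    0 < lowerDensityReal S := by
  obtain ⟨c, hc, h⟩ := exists_of_lowerDensityNat_pos hA
  have hpos : 0 < ENNReal.ofReal (η * (c / 2)) := ENNReal.ofReal_pos.2 (by positivity)
  refine hpos.trans_le (le_liminf_of_le (by isBoundedDefault) ?_)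
  -- Stopping at `⌊x⌋₊ - 1` keeps every interval `[n, n + η)` inside `[0, x]`; for `x ≥ 4` this
  -- costs at most half of `x`.
  have ht : Tendsto (fun x : ℝ => ⌊x⌋₊ - 1) atTop atTop :=
    (tendsto_sub_atTop_nat 1).comp tendsto_nat_floor_atTop
  filter_upwards [ht.eventually h, eventually_ge_atTop (4 : ℝ)] with x hx hx4
  have hfl : (4 : ℕ) ≤ ⌊x⌋₊ := Nat.le_floor (by exact_mod_cast hx4)
  have hfl1 := Nat.floor_le (show 0 ≤ x by linarith)
  have hfl2 := Nat.lt_floor_add_one x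
  set N := ⌊x⌋₊ - 1
  have hN : (⌊x⌋₊ : ℝ) = N + 1 := by
    have : ⌊x⌋₊ = N + 1 := by omega
    exact_mod_cast this
  have hfin : {n : ℕ | n ≤ N ∧ n ∈ A}.Finite := (finite_Iic N).subset fun n hn => hn.1
  rw [ENNReal.le_div_iff_mul_le (Or.inl (ENNReal.ofReal_pos.2 (by linarith)).ne')
    (Or.inl ENNReal.ofReal_ne_top)]
  have hsub : (⋃ n ∈ hfin.toFinset, Ico (n : ℝ) (n + η)) ⊆ ((↑) : ℝ≥0 → ℝ) '' S ∩ Icc 0 x := by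
    intro y hy
    simp only [mem_iUnion, Finite.mem_toFinset, mem_ofPred_eq, mem_Ico, exists_prop] at hy
    obtain ⟨n, ⟨hnN, hnA⟩, hy1, hy2⟩ := hy
    have hn0 : (0 : ℝ) ≤ n := Nat.cast_nonneg n
    have hnN' : (n : ℝ) ≤ N := by exact_mod_cast hnN
    exact ⟨⟨⟨y, hn0.trans hy1⟩, hS n hnA _ hy1 hy2, rfl⟩, hn0.trans hy1, by linarith⟩
  refine le_trans ?_ (measure_mono hsub)
  rw [measure_biUnion_finset]
  · simp only [Real.volume_Ico, add_sub_cancel_left, Finset.sum_const, nsmul_eq_mul]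
    rw [← ENNReal.ofReal_mul (by positivity), ← ENNReal.ofReal_natCast,
      ← ENNReal.ofReal_mul (by positivity), ← ncard_eq_toFinset_card _ hfin]
    refine ENNReal.ofReal_le_ofReal ?_
    have h3 : c / 2 * x ≤ c * N := by nlinarith
    nlinarith
  · intro i _ j _ hij
    refine disjoint_left.2 fun y hy1 hy2 => hij ?_
    have h1 : (i : ℝ) < j + 1 := by linarith [hy1.1, hy2.2]
    have h2 : (j : ℝ) < i + 1 := by linarith [hy2.1, hy1.2]
    have h1' : i < j + 1 := by exact_mod_cast h1
    have h2' : j < i + 1 := by exact_mod_cast h2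
    omega
  · exact fun _ _ => measurableSet_Ico

/-- If a set of times of positive lower density is covered by intervals of length two to the right
of the points of a set of natural numbers, then this set has positive lower density. -/
theorem lowerDensityNat_pos_of_cover {S : Set ℝ≥0} (hS : 0 < lowerDensityReal S) {A : Set ℕ}
    (hA : ∀ t ∈ S, ∃ n ∈ A, (n : ℝ) ≤ t ∧ (t : ℝ) < n + 2) : 0 < lowerDensityNat A := by
  obtain ⟨c, hc0, hc⟩ := exists_between hS
  have hc' : c ≠ ∞ := hc.ne_top
  have h := tendsto_natCast_atTop_atTop.eventually
    (eventually_lt_of_lt_liminf hc (by isBoundedDefault))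
  have hcpos : 0 < c.toReal := ENNReal.toReal_pos hc0.ne' hc'
  refine lowerDensityNat_pos (c := c.toReal / 2) (by positivity) ?_
  filter_upwards [h, eventually_gt_atTop 0] with N hN hN0
  have hN0' : (0 : ℝ) < N := by exact_mod_cast hN0
  have hfin : {n : ℕ | n ≤ N ∧ n ∈ A}.Finite := (finite_Iic N).subset fun n hn => hn.1
  have hsub : ((↑) : ℝ≥0 → ℝ) '' S ∩ Icc 0 (N : ℝ) ⊆
      ⋃ n ∈ hfin.toFinset, Ico (n : ℝ) (n + 2) := by
    rintro _ ⟨⟨t, ht, rfl⟩, -, htN⟩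
    obtain ⟨n, hn, h1, h2⟩ := hA t ht
    simp only [mem_iUnion, Finite.mem_toFinset, mem_ofPred_eq, mem_Ico, exists_prop]
    exact ⟨n, ⟨by exact_mod_cast h1.trans htN, hn⟩, h1, h2⟩
  have h1 := (ENNReal.lt_div_iff_mul_lt (Or.inl (ENNReal.ofReal_pos.2 hN0').ne')
    (Or.inl ENNReal.ofReal_ne_top)).1 hN
  have h2 : c * ENNReal.ofReal N ≤ ENNReal.ofReal
      (({n : ℕ | n ≤ N ∧ n ∈ A}.ncard : ℝ) * 2) := by
    refine h1.le.trans ((measure_mono hsub).trans ((measure_biUnion_finset_le _ _).trans ?_))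
    simp only [Real.volume_Ico, add_sub_cancel_left, Finset.sum_const, nsmul_eq_mul]
    rw [← ENNReal.ofReal_natCast, ← ENNReal.ofReal_mul (by positivity),
      ← ncard_eq_toFinset_card _ hfin]
  rw [← ENNReal.ofReal_toReal hc', ← ENNReal.ofReal_mul hcpos.le,
    ENNReal.ofReal_le_ofReal_iff (by positivity)] at h2
  linarith

/-! ### Necessity: density sets from visits to tents -/

theorem mem_c0Submodule_of_support {ρ u : ℝ → ℝ} (hu : Continuous u) {R : ℝ}
    (h : ∀ x, R < |x| → u x = 0) : u ∈ c0Submodule ρ := by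
  refine ⟨hu, ?_, ?_⟩
  · refine tendsto_const_nhds.congr' ?_
    filter_upwards [tendsto_abs_atTop_atTop.eventually_gt_atTop R] with x hx
    rw [h x hx, zero_mul]
  · refine tendsto_const_nhds.congr' ?_
    filter_upwards [tendsto_abs_atBot_atTop.eventually_gt_atTop R] with x hx
    rw [h x hx, zero_mul]

/-- The tent function of height `a` and support `[-1/4, 1/4]`. -/
def tent (a x : ℝ) : ℝ := max 0 (a * (1 - 4 * |x|))

theorem continuous_tent (a : ℝ) : Continuous (tent a) := by
  unfold tent; fun_prop

theorem tent_eq_zero {a : ℝ} (ha : 0 ≤ a) {x : ℝ} (hx : 1 / 4 ≤ |x|) : tent a x = 0 :=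
  max_eq_left (mul_nonpos_of_nonneg_of_nonpos ha (by linarith))

theorem tent_zero {a : ℝ} (ha : 0 ≤ a) : tent a 0 = a := by
  simp [tent, ha]

theorem tent_le {a : ℝ} (ha : 0 ≤ a) (x : ℝ) : tent a x ≤ a :=
  max_le ha (mul_le_of_le_one_right ha (by linarith [abs_nonneg x]))

theorem FrequentlyHypercyclic.exists_densityConditions {ρ : ℝ → ℝ} {hρ : IsAdmissibleWeight ρ}
    (hsup : BddAbove (Set.range fun k : ℤ => ρ ((k : ℝ) + 1) / ρ (k : ℝ)))
    (hT : FrequentlyHypercyclic (C0Weighted.translation hρ)) {M : ℕ → ℝ}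
    (hM : ∀ p, 1 ≤ p → 0 < M p) : ∃ E : ℕ → Set ℕ, DensityConditions ρ M E := by
  obtain ⟨f, hf⟩ := hT
  obtain ⟨D, hD, hcomp⟩ := hρ.exists_comparison hsup
  have hD0 : 0 < D := by linarith
  -- Gaps of 3 distinguish heights known up to an error of 1; the term with `D` serves (d). The
  -- absolute values make `a` increasing for any `M`.
  set a : ℕ → ℝ := fun p => 3 * (p + 1) + D * ∑ q ∈ Finset.range (p + 1), |M q|
  have ha_lt : ∀ {p q : ℕ}, p < q → a p + 3 ≤ a q := by
    intro p q hpq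
    have h1 : (p : ℝ) + 1 ≤ q := by exact_mod_cast hpq
    have h2 : ∑ i ∈ Finset.range (p + 1), |M i| ≤ ∑ i ∈ Finset.range (q + 1), |M i| :=
      Finset.sum_le_sum_of_subset_of_nonneg (Finset.range_subset_range.2 (by omega))
        fun _ _ _ => abs_nonneg _
    have h3 := mul_le_mul_of_nonneg_left h2 hD0.le
    simp only [a]
    linarith
  have ha3 : ∀ p, 3 ≤ a p := fun p => by
    have : 0 ≤ D * ∑ q ∈ Finset.range (p + 1), |M q| := by positivity
    have : (0 : ℝ) ≤ p := Nat.cast_nonneg p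
    simp only [a]
    linarith
  have ha0 : ∀ p, 0 ≤ a p := fun p => by linarith [ha3 p]
  have haM : ∀ p, D * M p + 3 ≤ a p := fun p => by
    have h1 : |M p| ≤ ∑ q ∈ Finset.range (p + 1), |M q| :=
      Finset.single_le_sum (f := fun q => |M q|) (fun _ _ => abs_nonneg _)
        (Finset.mem_range.2 (Nat.lt_succ_self p))
    have h2 := mul_le_mul_of_nonneg_left ((le_abs_self _).trans h1) hD0.le
    have : (0 : ℝ) ≤ p := Nat.cast_nonneg p
    simp only [a]
    linarith
  -- The first bound gives (d). The second is a lower bound for `ρ` on `[-(2p + 4), 2p + 4]`, so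
  -- weighted closeness implies an error below 1 on that window.
  set δ : ℕ → ℝ := fun p => min (1 / M p) (ρ 0 / D ^ (2 * p + 4))
  have hδ : ∀ p, 1 ≤ p → 0 < δ p := fun p hp =>
    lt_min (one_div_pos.2 (hM p hp)) (div_pos (hρ.pos 0) (by positivity))
  have hmem : ∀ p, tent (a p) ∈ c0Submodule ρ := fun p =>
    mem_c0Submodule_of_support (continuous_tent _) fun x hx => tent_eq_zero (ha0 p) hx.le
  set g : ℕ → C0Weighted hρ := fun p => C0Weighted.mk hρ (tent (a p)) (hmem p)
  set A : ℕ → Set ℝ≥0 := fun p => {t | C0Weighted.translation hρ t f ∈ Metric.ball (g p) (δ p)}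
  have hA : ∀ p, 1 ≤ p → 0 < lowerDensityReal (A p) := fun p hp =>
    hf _ Metric.isOpen_ball ⟨g p, Metric.mem_ball_self (hδ p hp)⟩
  have key1 : ∀ {p : ℕ} {t : ℝ≥0}, t ∈ A p → ∀ y : ℝ,
      |f y - tent (a p) (y - t)| * ρ (y - t) < δ p := by
    intro p t ht y
    have h1 : ‖C0Weighted.translation hρ t f - g p‖ < δ p := mem_ball_iff_norm.1 ht
    have h2 := C0Weighted.le_supNorm (C0Weighted.translation hρ t f - g p) (y - t)
    have h3 : (C0Weighted.translation hρ t f - g p) (y - t) = f y - tent (a p) (y - t) := by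
      change f (y - t + t) - tent (a p) (y - t) = _
      rw [sub_add_cancel]
    rw [h3] at h2
    exact h2.trans_lt h1
  have key2 : ∀ {p : ℕ} {t : ℝ≥0}, t ∈ A p → ∀ y : ℝ, |y - t| ≤ 2 * p + 4 →
      |f y - tent (a p) (y - t)| < 1 := by
    intro p t ht y hy
    have h1 := (key1 ht y).trans_le (min_le_right _ _)
    have h2 := div_pow_le_of_comparison hD hcomp (2 * p + 4) (y - t) (by push_cast; exact hy)
    have h3 : |f y - tent (a p) (y - t)| * ρ (y - t) < 1 * ρ (y - t) := by
      rw [one_mul]; exact h1.trans_le h2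
    exact lt_of_mul_lt_mul_right h3 (hρ.pos _).le
  have key3 : ∀ {p : ℕ} {t : ℝ≥0}, t ∈ A p → a p - 1 < f t := by
    intro p t ht
    have h1 := key2 ht t (by rw [sub_self, abs_zero]; positivity)
    rw [sub_self, tent_zero (ha0 p)] at h1
    linarith [(abs_lt.1 h1).1]
  have key4 : ∀ {p : ℕ} {t s : ℝ≥0}, t ∈ A p → s ∈ A p → |(s : ℝ) - t| ≤ 4 →
      |(s : ℝ) - t| < 1 / 4 := by
    intro p t s ht hs hst
    by_contra! hlt
    have h1 := key2 ht s (hst.trans (by linarith [Nat.cast_nonneg (α := ℝ) p]))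
    rw [tent_eq_zero (ha0 p) hlt, sub_zero] at h1
    linarith [(abs_lt.1 h1).2, key3 hs, ha3 p]
  have key5 : ∀ {p q : ℕ} {t s : ℝ≥0}, q < p → t ∈ A p → s ∈ A q →
      (p : ℝ) + q + 1 < |(s : ℝ) - t| := by
    intro p q t s hqp ht hs
    by_contra! hst
    have hqp' : (q : ℝ) < p := by exact_mod_cast hqp
    have h1 := key2 ht s (by linarith)
    -- Far from `t`, the peak at `s` stands where the tent at `t` vanishes; close to `t`, the peak
    -- at `t` is too high for the tent at `s`.
    rcases le_or_gt (1 / 4) |(s : ℝ) - t| with hlt | hlt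
    · rw [tent_eq_zero (ha0 p) hlt, sub_zero] at h1
      linarith [(abs_lt.1 h1).2, key3 hs, ha3 q]
    · rw [abs_sub_comm] at hlt
      have h2 := key2 hs t (by linarith [Nat.cast_nonneg (α := ℝ) q])
      linarith [(abs_lt.1 h2).2, key3 ht, ha_lt hqp, tent_le (ha0 q) ((t : ℝ) - s)]
  have key5' : ∀ {p q : ℕ} {t s : ℝ≥0}, p ≠ q → t ∈ A p → s ∈ A q →
      (p : ℝ) + q + 1 < |(s : ℝ) - t| := by
    intro p q t s hpq ht hs
    rcases hpq.lt_or_gt with h | h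
    · have := key5 h hs ht
      rw [abs_sub_comm] at this
      linarith
    · exact key5 h ht hs
  -- Keep `n` if there is a visit in `[n, n + 1)` but none in `[n - 1, n)`. Visits belonging to
  -- distinct kept integers are then more than 1 apart, so each tent vanishes at the other visit.
  set E : ℕ → Set ℕ := fun p => {n | (∃ t ∈ A p, (n : ℝ) ≤ t ∧ (t : ℝ) < n + 1) ∧
    ∀ t ∈ A p, (t : ℝ) < n → (t : ℝ) < n - 1}
  have hE_lt : ∀ {p n m : ℕ} {t s : ℝ≥0}, n ∈ E p → m ∈ E p → n < m → t ∈ A p → s ∈ A p →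
      (t : ℝ) < n + 1 → (m : ℝ) ≤ s → 1 < (s : ℝ) - t := by
    intro p n m t s hn hm hnm ht hs htn hsm
    have hnm' : (n : ℝ) + 1 ≤ m := by exact_mod_cast hnm
    linarith [hm.2 t ht (by linarith)]
  have hE_zero : ∀ {p q n m : ℕ} {t s : ℝ≥0}, m ≠ n → n ∈ E p → m ∈ E q → t ∈ A p → s ∈ A q →
      (n : ℝ) ≤ t → (t : ℝ) < n + 1 → (m : ℝ) ≤ s → (s : ℝ) < m + 1 →
      1 / 4 ≤ |(s : ℝ) - t| := by
    intro p q n m t s hmn hn hm ht hs h1 h2 h3 h4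
    by_cases hpq : p = q
    · subst hpq
      rcases hmn.lt_or_gt with h | h
      · have := hE_lt hm hn h hs ht h4 h1
        rw [abs_sub_comm]
        linarith [le_abs_self ((t : ℝ) - s)]
      · have := hE_lt hn hm h ht hs h2 h3
        linarith [le_abs_self ((s : ℝ) - t)]
    · linarith [key5' hpq ht hs, Nat.cast_nonneg (α := ℝ) p, Nat.cast_nonneg (α := ℝ) q]
  have habs : ∀ {n m : ℕ} {t s : ℝ≥0}, (n : ℝ) ≤ t → (t : ℝ) < n + 1 → (m : ℝ) ≤ s →
      (s : ℝ) < m + 1 → |((m : ℝ) - n) - (s - t)| ≤ 1 := by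
    intro n m t s h1 h2 h3 h4
    exact abs_le.2 ⟨by linarith, by linarith⟩
  refine ⟨E, fun p hp => ?_, fun p q hp hq hpq => ?_, fun p hp => ?_, fun p q hp hq n hn m hm hmn => ?_⟩
  · refine lowerDensityNat_pos_of_cover (hA p hp) fun t ht => ?_
    have h1 : (⌊(t : ℝ)⌋₊ : ℝ) ≤ t := Nat.floor_le t.coe_nonneg
    have h2 := Nat.lt_floor_add_one (t : ℝ)
    set n := ⌊(t : ℝ)⌋₊
    by_cases hn : n ∈ E p
    · exact ⟨n, hn, h1, by linarith⟩
    -- If `n` is dropped, then `n - 1` is kept: a visit in `[n - 2, n - 1)` would be within 4 of `t`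
    -- but more than `1 / 4` away, against `key4`. Hence intervals of length two cover all visits.
    · have hs : ∃ s ∈ A p, (s : ℝ) < n ∧ (n : ℝ) - 1 ≤ s := by
        by_contra! hcon
        exact hn ⟨⟨t, ht, h1, h2⟩, hcon⟩
      obtain ⟨s, hs, hsn, hns⟩ := hs
      have hn0 : 0 < n := by
        have : (0 : ℝ) < n := s.2.trans_lt hsn
        exact_mod_cast this
      have hcast : ((n - 1 : ℕ) : ℝ) = n - 1 := by
        rw [Nat.cast_sub hn0, Nat.cast_one]
      refine ⟨n - 1, ⟨⟨s, hs, by rwa [hcast], by rwa [hcast, sub_add_cancel]⟩,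
        fun r hr hrn => ?_⟩, by rw [hcast]; linarith, by rw [hcast]; linarith⟩
      rw [hcast] at hrn ⊢
      by_contra! hcon
      have := key4 hr ht (abs_le.2 ⟨by linarith, by linarith⟩)
      linarith [le_abs_self ((t : ℝ) - r)]
  · refine disjoint_left.2 ?_
    rintro _ ⟨_, ⟨n, hn, rfl⟩, i, hi, rfl⟩ ⟨_, ⟨m, hm, rfl⟩, j, hj, hij⟩
    obtain ⟨⟨t, ht, h1, h2⟩, -⟩ := hn
    obtain ⟨⟨s, hs, h3, h4⟩, -⟩ := hm
    have h5 := key5' hpq ht hs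
    have hij' : (m : ℝ) + j = n + i := by exact_mod_cast hij
    have hi1 : -(p : ℝ) ≤ i := by exact_mod_cast hi.1
    have hi2 : (i : ℝ) ≤ p := by exact_mod_cast hi.2
    have hj1 : -(q : ℝ) ≤ j := by exact_mod_cast hj.1
    have hj2 : (j : ℝ) ≤ q := by exact_mod_cast hj.2
    refine absurd h5 (not_lt.2 (abs_le.2 ⟨by linarith, by linarith⟩))
  · rw [Metric.tendsto_nhds]
    intro ε hε
    have hfρ := (f.coe_mem).2.1
    have h1 := (Metric.tendsto_nhds.1 hfρ) (ε / D) (div_pos hε hD0)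
    obtain ⟨X, hX⟩ := eventually_atTop.1 h1
    have h2 := (tendsto_natCast_atTop_atTop (R := ℝ)).eventually_ge_atTop X
    rw [eventually_inf_principal]
    filter_upwards [h2] with n hn hnE
    obtain ⟨⟨t, ht, h3, h4⟩, -⟩ := hnE
    have h5 := hX t (hn.trans h3)
    have h6 : 1 ≤ f t := by linarith [key3 ht, ha3 p]
    rw [dist_zero_right, Real.norm_eq_abs, abs_of_pos (mul_pos (by linarith) (hρ.pos _)),
      lt_div_iff₀ hD0] at h5
    rw [dist_zero_right, Real.norm_of_nonneg (hρ.pos _).le]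
    calc ρ n ≤ D * ρ t := hcomp _ _ (abs_le.2 ⟨by linarith, by linarith⟩)
      _ ≤ D * (f t * ρ t) := by
        gcongr
        exact le_mul_of_one_le_left (hρ.pos _).le h6
      _ < ε := by linarith
  · obtain ⟨t, ht, h1, h2⟩ := hn.1
    obtain ⟨s, hs, h3, h4⟩ := hm.1
    -- At `s` the tent centred at `t` vanishes, while `f s` exceeds `D * M q`.
    have h5 := key1 ht s
    rw [tent_eq_zero (ha0 p) (hE_zero hmn hn hm ht hs h1 h2 h3 h4), sub_zero] at h5
    have h6 := h5.trans_le (min_le_left _ _)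
    have h7 : D * M q ≤ |f s| := by linarith [key3 hs, haM q, le_abs_self (f s)]
    have h8 := mul_le_mul_of_nonneg_right h7 (hρ.pos ((s : ℝ) - t)).le
    have h9 := hcomp _ _ (habs h1 h2 h3 h4)
    have hMp := hM p hp
    have hMq := hM q hq
    rw [lt_div_iff₀ hMp] at h6
    rw [le_div_iff₀ (mul_pos hMp hMq)]
    calc ρ ((m : ℝ) - n) * (M p * M q) ≤ D * ρ ((s : ℝ) - t) * (M p * M q) := by gcongr
      _ = D * M q * ρ ((s : ℝ) - t) * M p := by ring
      _ ≤ |f s| * ρ ((s : ℝ) - t) * M p := by gcongr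
      _ ≤ 1 := h6.le

/-! ### Sufficiency: gluing translates along the density sets -/

/-- Translates of compactly supported continuous functions to well separated integers can be glued
to one continuous function. -/
theorem exists_continuous_glue {F : ℕ → Set ℕ} {R : ℕ → ℕ} {g : ℕ → ℝ → ℝ}
    (hg : ∀ k, Continuous (g k)) (hsupp : ∀ k x, (R k : ℝ) < |x| → g k x = 0)
    (hsep : ∀ k l n m, n ∈ F k → m ∈ F l → (k, n) ≠ (l, m) →
      (R k : ℝ) + R l + 2 ≤ |(n : ℝ) - m|) :
    ∃ f : ℝ → ℝ, Continuous f ∧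
      (∀ k, ∀ n ∈ F k, ∀ x : ℝ, |x - n| < R k + 1 → f x = g k (x - n)) ∧
      ∀ x : ℝ, (∀ k, ∀ n ∈ F k, (R k : ℝ) < |x - n|) → f x = 0 := by
  classical
  -- The open windows exceed the supports by 1, so that `f` is a single translate near each support;
  -- the 2 in `hsep` keeps them disjoint.
  set P : ℝ → ℕ × ℕ → Prop := fun x i => i.2 ∈ F i.1 ∧ |x - i.2| < R i.1 + 1
  have huniq : ∀ x i j, P x i → P x j → i = j := by
    rintro x ⟨k, n⟩ ⟨l, m⟩ ⟨hn, h1⟩ ⟨hm, h2⟩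
    by_contra hne
    have h3 := hsep k l n m hn hm hne
    have h4 := abs_sub_le (n : ℝ) x m
    rw [abs_sub_comm (n : ℝ) x] at h4
    dsimp only at h1 h2
    linarith
  set f : ℝ → ℝ := fun x =>
    if h : ∃ i, P x i then g h.choose.1 (x - h.choose.2) else 0 with hf
  have hf1 : ∀ k, ∀ n ∈ F k, ∀ x : ℝ, |x - n| < R k + 1 → f x = g k (x - n) := by
    intro k n hn x hx
    have hP : P x (k, n) := ⟨hn, hx⟩
    have h : ∃ i, P x i := ⟨_, hP⟩
    have h2 : h.choose = (k, n) := huniq x _ _ h.choose_spec hP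
    rw [hf]
    simp only [dif_pos h, h2]
  have hf2 : ∀ x : ℝ, (∀ k, ∀ n ∈ F k, (R k : ℝ) < |x - n|) → f x = 0 := by
    intro x hx
    by_cases h : ∃ i, P x i
    · obtain ⟨⟨k, n⟩, hn, h1⟩ := h
      rw [hf1 k n hn x h1, hsupp k _ (hx k n hn)]
    · simp only [hf, dif_neg h]
  refine ⟨f, continuous_iff_continuousAt.2 fun x => ?_, hf1, hf2⟩
  by_cases h : ∃ i, P x i
  · obtain ⟨⟨k, n⟩, hn, h1⟩ := h
    have h2 : ContinuousAt (fun y => g k (y - n)) x :=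
      ((hg k).comp (continuous_id.sub continuous_const)).continuousAt
    refine h2.congr ?_
    have h3 : ∀ᶠ y : ℝ in 𝓝 x, |y - n| < R k + 1 :=
      (continuous_abs.comp (continuous_id.sub continuous_const)).continuousAt.eventually_lt
        continuousAt_const h1
    filter_upwards [h3] with y hy
    exact (hf1 k n hn y hy).symm
  -- A point in no window has distance at least 1 from every support interval, so `f` vanishes on
  -- its unit ball.
  · push Not at h
    refine (continuousAt_const (y := (0 : ℝ))).congr ?_
    filter_upwards [Metric.ball_mem_nhds x one_pos] with y hy
    refine (hf2 y fun k n hn => ?_).symm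
    by_contra! hle
    refine h (k, n) ⟨hn, ?_⟩
    have h1 := abs_sub_le x y n
    rw [Metric.mem_ball, Real.dist_eq, abs_sub_comm] at hy
    dsimp only
    linarith

theorem mem_c0Submodule_of_small {ρ u : ℝ → ℝ} (hρ : ∀ x, 0 < ρ x) (hu : Continuous u)
    (h : ∀ ε > 0, ∃ X, ∀ x, X < |x| → |u x| * ρ x < ε) : u ∈ c0Submodule ρ := by
  refine ⟨hu, ?_, ?_⟩ <;> rw [Metric.tendsto_nhds] <;> intro ε hε <;> obtain ⟨X, hX⟩ := h ε hε
  · filter_upwards [tendsto_abs_atTop_atTop.eventually_gt_atTop X] with x hx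
    rw [dist_zero_right, norm_mul, Real.norm_of_nonneg (hρ x).le]
    exact hX x hx
  · filter_upwards [tendsto_abs_atBot_atTop.eventually_gt_atTop X] with x hx
    rw [dist_zero_right, norm_mul, Real.norm_of_nonneg (hρ x).le]
    exact hX x hx

/-- Under the density conditions there is an element of the space whose orbit approximates each of
countably many compactly supported functions along one of the sets `E p`. -/
theorem DensityConditions.exists_approximating {ρ : ℝ → ℝ} (hρ : IsAdmissibleWeight ρ) {D : ℝ}
    (hD : 1 ≤ D) (hcomp : ∀ x y : ℝ, |x - y| ≤ 1 → ρ x ≤ D * ρ y) {M : ℕ → ℝ}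
    (hM : ∀ p, 1 ≤ p → 0 < M p) (hMt : Tendsto M atTop atTop) {E : ℕ → Set ℕ}
    (hE : DensityConditions ρ M E) {g : ℕ → ℝ → ℝ} {R : ℕ → ℕ} {B : ℕ → ℝ}
    (hg : ∀ k, Continuous (g k)) (hsupp : ∀ k x, (R k : ℝ) < |x| → g k x = 0)
    (hB : ∀ k x, |g k x| ≤ B k) :
    ∃ φ : ℕ → ℕ, (∀ k, 1 ≤ φ k) ∧ ∃ f ∈ c0Submodule ρ, ∀ k, ∀ n ∈ E (φ k), ∀ x : ℝ,
      |f (x + n) - g k x| * ρ x ≤ 1 / (k + 1) := by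
  have hD0 : 0 < D := by linarith
  have hρ0 := hρ.pos 0
  have hB0 : ∀ k, 0 ≤ B k := fun k => (abs_nonneg _).trans (hB k 0)
  -- The summands serve, in order, to bound `g l` against `N l`, to get `1 / N k ≤ 1 / (k + 1)`, and
  -- to separate points of the same set.
  set W : ℕ → ℝ := fun k => (k + 1) * (B k * D ^ R k) + (k + 1) + D ^ (2 * R k + 2) / ρ 0
  obtain ⟨φ, hφ, hφW⟩ := extraction_forall_of_eventually (P := fun k p => R k + 1 ≤ p ∧ W k < M p)
    fun k => (eventually_ge_atTop (R k + 1)).and (hMt.eventually_gt_atTop (W k))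
  have hφ1 : ∀ k, 1 ≤ φ k := fun k => by have := (hφW k).1; omega
  set N : ℕ → ℝ := fun k => M (φ k)
  have hN0 : ∀ k, 0 < N k := fun k => hM _ (hφ1 k)
  have hW1 : ∀ k : ℕ, 0 ≤ ((k : ℝ) + 1) * (B k * D ^ R k) := fun k => by
    have := hB0 k
    positivity
  have hW2 : ∀ k : ℕ, 0 < D ^ (2 * R k + 2) / ρ 0 := fun k => by positivity
  have hN1 : ∀ k : ℕ, ((k : ℝ) + 1) * (B k * D ^ R k) ≤ N k := fun k => by
    have h1 : W k < N k := (hφW k).2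
    have := Nat.cast_nonneg (α := ℝ) k
    simp only [W] at h1
    linarith [hW2 k]
  have hN2 : ∀ k : ℕ, (k : ℝ) + 1 ≤ N k := fun k => by
    have h1 : W k < N k := (hφW k).2
    simp only [W] at h1
    linarith [hW1 k, hW2 k]
  have hN3 : ∀ k : ℕ, D ^ (2 * R k + 2) / ρ 0 < N k := fun k => by
    have h1 : W k < N k := (hφW k).2
    have := Nat.cast_nonneg (α := ℝ) k
    simp only [W] at h1
    linarith [hW1 k]
  have hN4 : ∀ k, 1 ≤ N k := fun k => by linarith [hN2 k, Nat.cast_nonneg (α := ℝ) k]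
  set F : ℕ → Set ℕ := fun k => E (φ k)
  have hle : ∀ k l n m, n ∈ F k → m ∈ F l → m ≠ n → ρ ((m : ℝ) - n) ≤ 1 / (N k * N l) :=
    fun k l n m hn hm hmn => hE.le_inv _ _ (hφ1 k) (hφ1 l) n hn m hm hmn
  have hsep : ∀ k l n m, n ∈ F k → m ∈ F l → (k, n) ≠ (l, m) →
      (R k : ℝ) + R l + 2 ≤ |(n : ℝ) - m| := by
    intro k l n m hn hm hne
    by_contra! hlt
    -- Within one set, (d) makes `ρ (m - n)` too small for `m - n` to be short. For different sets,
    -- (b) applies because `R k + 1 ≤ φ k`.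
    by_cases hkl : k = l
    · subst hkl
      have hnm : m ≠ n := fun h => hne (by rw [h])
      have h1 := hle k k n m hn hm hnm
      have h2 := div_pow_le_of_comparison hD hcomp (2 * R k + 2) ((m : ℝ) - n) (by
        rw [abs_sub_comm]; push_cast; linarith)
      have h3 := h2.trans h1
      have h4 := hN3 k
      rw [div_lt_iff₀ hρ0] at h4
      rw [div_le_div_iff₀ (by positivity) (mul_pos (hN0 k) (hN0 k)), one_mul] at h3
      have h5 : N k * ρ 0 ≤ ρ 0 * (N k * N k) := by
        have := mul_le_mul_of_nonneg_left (hN4 k) (mul_pos (hN0 k) hρ0).le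
        linarith
      linarith
    · have h1 := (hφW k).1
      have h2 := (hφW l).1
      have h3 := hE.disjoint (φ k) (φ l) (hφ1 k) (hφ1 l) (hφ.injective.ne hkl)
      have h4 : |(n : ℤ) - m| < R k + R l + 2 := by exact_mod_cast hlt
      rw [abs_lt] at h4
      -- The shift `i` absorbs as much of the gap as `φ k` allows, and `j` the remainder.
      have h5 : ∃ i ∈ Icc (-(φ k : ℤ)) (φ k), ∃ j ∈ Icc (-(φ l : ℤ)) (φ l),
          (n : ℤ) + i = m + j := by
        rcases le_total (n : ℤ) m with h | h
        · refine ⟨min (φ k : ℤ) (m - n), ⟨by omega, by omega⟩,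
            min (φ k : ℤ) (m - n) - (m - n), ⟨by omega, by omega⟩, by omega⟩
        · refine ⟨-min (φ k : ℤ) (n - m), ⟨by omega, by omega⟩,
            (n - m) - min (φ k : ℤ) (n - m), ⟨by omega, by omega⟩, by omega⟩
      obtain ⟨i, hi, j, hj, hij⟩ := h5
      exact disjoint_left.1 h3 (add_mem_add (mem_image_of_mem _ hn) hi)
        (hij ▸ add_mem_add (mem_image_of_mem _ hm) hj)
  obtain ⟨f, hfc, hf1, hf2⟩ := exists_continuous_glue hg hsupp hsep
  have hpow : ∀ l, ∀ x y : ℝ, |x - y| ≤ R l → ρ x ≤ D ^ R l * ρ y := fun l =>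
    le_pow_mul_of_comparison hD hcomp (R l)
  have hgρ : ∀ l (y x z : ℝ), |x - z| ≤ R l → |g l y| * ρ x ≤ B l * D ^ R l * ρ z := by
    intro l y x z hxz
    rw [mul_assoc]
    exact mul_le_mul (hB l y) (hpow l x z hxz) (hρ.pos _).le (hB0 l)
  have hdiv : ∀ l : ℕ, B l * D ^ R l / N l ≤ 1 / (l + 1) := fun l => by
    rw [div_le_div_iff₀ (hN0 l) (by positivity)]
    linarith [hN1 l]
  refine ⟨φ, hφ1, f, mem_c0Submodule_of_small hρ.pos hfc fun ε hε => ?_, fun k n hn x => ?_⟩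
  -- A fixed base point turns (d) into decay of `ρ m`: it is at most `D ^ n₀ * ρ (m - n₀)`. This
  -- handles all `l > L`; the finitely many `l ≤ L` use (c).
  · obtain ⟨n₀, hn₀⟩ : (F 0).Nonempty :=
      nonempty_of_lowerDensityNat_pos (hE.pos_density _ (hφ1 0))
    obtain ⟨L, hL⟩ := exists_nat_gt (D ^ n₀ / ε)
    have hX : ∀ l, ∃ X : ℝ, ∀ m ∈ F l, ∀ x : ℝ, X < |x| → |x - m| ≤ R l →
        |g l (x - m)| * ρ x < ε := by
      intro l
      have h1 := (hE.tendsto_zero _ (hφ1 l)).const_mul (B l * D ^ R l)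
      rw [mul_zero] at h1
      have h2 := h1.eventually_lt_const hε
      rw [eventually_inf_principal] at h2
      obtain ⟨m₀, hm₀⟩ := eventually_atTop.1 h2
      refine ⟨m₀ + R l, fun m hm x hx hxm => (hgρ l _ _ _ hxm).trans_lt (hm₀ m ?_ hm)⟩
      have h3 := abs_sub_abs_le_abs_sub x m
      rw [Nat.abs_cast] at h3
      have h4 : (m₀ : ℝ) < m := by linarith
      exact_mod_cast h4.le
    choose X hX using hX
    refine ⟨∑ l ∈ Finset.range (L + 1), |X l|, fun x hx => ?_⟩
    by_cases hblock : ∃ l, ∃ m ∈ F l, |x - m| ≤ R l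
    · obtain ⟨l, m, hm, hxm⟩ := hblock
      rw [hf1 l m hm x (by linarith)]
      rcases le_or_gt l L with hl | hl
      · refine hX l m hm x (lt_of_le_of_lt ?_ hx) hxm
        exact (le_abs_self _).trans (Finset.single_le_sum (f := fun l => |X l|)
          (fun _ _ => abs_nonneg _) (Finset.mem_range.2 (Nat.lt_succ_of_le hl)))
      · have hmn : m ≠ n₀ := by
          rintro rfl
          have h1 := hsep 0 l m m hn₀ hm (fun h => by
            have := congrArg Prod.fst h
            dsimp only at this
            omega)
          rw [sub_self, abs_zero] at h1
          have : (0 : ℝ) < (R 0 : ℝ) + R l + 2 := by positivity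
          linarith
        have h1 := hle 0 l n₀ m hn₀ hm hmn
        have h2 := le_pow_mul_of_comparison hD hcomp n₀ m ((m : ℝ) - n₀) (by
          rw [sub_sub_cancel, Nat.abs_cast])
        have h3 : 1 / (N 0 * N l) ≤ 1 / N l :=
          one_div_le_one_div_of_le (hN0 l) (le_mul_of_one_le_left (hN0 l).le (hN4 0))
        have hBl := hB0 l
        have hlL : (L : ℝ) < l + 1 := by
          have : (L : ℝ) < l := by exact_mod_cast hl
          linarith
        calc |g l (x - m)| * ρ x ≤ B l * D ^ R l * ρ m := hgρ l _ _ _ hxm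
          _ ≤ B l * D ^ R l * (D ^ n₀ * (1 / N l)) := by
            gcongr
            exact h2.trans (by gcongr; exact h1.trans h3)
          _ = D ^ n₀ * (B l * D ^ R l / N l) := by ring
          _ ≤ D ^ n₀ * (1 / (l + 1)) := mul_le_mul_of_nonneg_left (hdiv l) (by positivity)
          _ = D ^ n₀ / (l + 1) := by ring
          _ < ε := by
            rw [div_lt_iff₀ hε] at hL
            rw [div_lt_iff₀ (by positivity)]
            nlinarith
    · push Not at hblock
      rw [hf2 x hblock, abs_zero, zero_mul]
      exact hε
  · have hk : (0 : ℝ) ≤ 1 / (k + 1) := by positivity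
    by_cases hblock : ∃ l, ∃ m ∈ F l, |x + n - m| ≤ R l
    · obtain ⟨l, m, hm, hxm⟩ := hblock
      rw [hf1 l m hm (x + n) (by linarith)]
      by_cases heq : (k, n) = (l, m)
      · obtain ⟨rfl, rfl⟩ := Prod.mk.inj heq
        rw [add_sub_cancel_right, sub_self, abs_zero, zero_mul]
        exact hk
      -- Another translate is active at `x + n`, so `x` lies off the support of `g k` and the error
      -- is that translate alone.
      · have h1 := hsep k l n m hn hm heq
        have h2 : (R k : ℝ) < |x| := by
          have h3 := abs_sub_le (n : ℝ) (x + n) m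
          rw [show (n : ℝ) - (x + n) = -x by ring, abs_neg] at h3
          linarith
        have hmn : m ≠ n := by
          rintro rfl
          rw [sub_self, abs_zero] at h1
          have : (0 : ℝ) < (R k : ℝ) + R l + 2 := by positivity
          linarith
        have hBl := hB0 l
        have hNk := hN0 k
        rw [hsupp k x h2, sub_zero]
        calc |g l (x + n - m)| * ρ x ≤ B l * D ^ R l * ρ ((m : ℝ) - n) :=
              hgρ l _ _ _ (by rwa [show x - ((m : ℝ) - n) = x + n - m by ring])
          _ ≤ B l * D ^ R l * (1 / (N k * N l)) := by
            gcongr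
            exact hle k l n m hn hm hmn
          _ = 1 / N k * (B l * D ^ R l / N l) := by ring
          _ ≤ 1 / N k * (1 / (l + 1)) := mul_le_mul_of_nonneg_left (hdiv l) (by positivity)
          _ ≤ 1 / N k * 1 := by
            gcongr
            rw [div_le_one (by positivity)]
            linarith [Nat.cast_nonneg (α := ℝ) l]
          _ ≤ 1 / (k + 1) := by
            rw [mul_one]
            exact one_div_le_one_div_of_le (by positivity) (hN2 k)
    · push Not at hblock
      have h1 := hblock k n hn
      rw [add_sub_cancel_right] at h1
      rw [hf2 _ hblock, hsupp k x h1, sub_zero, abs_zero, zero_mul]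
      exact hk

/-! ### Sufficiency: dense sequence and passage to real times -/

/-- A continuous cutoff function, equal to one on `[-r, r]` and to zero off `[-r - 1, r + 1]`. -/
def cutoff (r x : ℝ) : ℝ := max 0 (min 1 (r + 1 - |x|))

theorem continuous_cutoff (r : ℝ) : Continuous (cutoff r) := by
  unfold cutoff; fun_prop

theorem cutoff_nonneg (r x : ℝ) : 0 ≤ cutoff r x := le_max_left _ _

theorem cutoff_le_one (r x : ℝ) : cutoff r x ≤ 1 := max_le zero_le_one (min_le_left _ _)

theorem cutoff_eq_one {r x : ℝ} (h : |x| ≤ r) : cutoff r x = 1 := by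
  rw [cutoff, min_eq_left (by linarith), max_eq_right zero_le_one]

theorem cutoff_eq_zero {r x : ℝ} (h : r + 1 < |x|) : cutoff r x = 0 :=
  max_eq_left ((min_le_right _ _).trans (by linarith))

/-- There are countably many compactly supported continuous functions that approximate each element
of the space, each infinitely often. -/
theorem exists_dense_compactly_supported {ρ : ℝ → ℝ} (hρ : IsAdmissibleWeight ρ) :
    ∃ (g : ℕ → ℝ → ℝ) (R : ℕ → ℕ), (∀ k, Continuous (g k)) ∧
      (∀ k x, (R k : ℝ) < |x| → g k x = 0) ∧
      ∀ u ∈ c0Submodule ρ, ∀ ε > 0, ∀ K : ℕ, ∃ k ≥ K, ∀ x, |g k x - u x| * ρ x ≤ ε := by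
  set h : ℕ → C(ℝ, ℝ) := TopologicalSpace.denseSeq C(ℝ, ℝ)
  -- The index encodes a function dense in the compact-open topology, a cutoff radius, and a dummy
  -- number that repeats each product infinitely often.
  refine ⟨fun k x => cutoff k.unpair.1.unpair.2 x * h k.unpair.1.unpair.1 x,
    fun k => k.unpair.1.unpair.2 + 1,
    fun k => (continuous_cutoff _).mul (h _).continuous, fun k x hx => ?_,
    fun u hu ε hε K => ?_⟩
  · push_cast at hx
    dsimp only
    rw [cutoff_eq_zero hx, zero_mul]
  · obtain ⟨huc, hu1, hu2⟩ := hu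
    have e1 := (Metric.tendsto_nhds.1 hu1) (ε / 2) (half_pos hε)
    have e2 := (Metric.tendsto_nhds.1 hu2) (ε / 2) (half_pos hε)
    obtain ⟨b, hb⟩ := eventually_atTop.1 e1
    obtain ⟨c, hc⟩ := eventually_atBot.1 e2
    obtain ⟨r, hr⟩ := exists_nat_ge (max |b| |c|)
    have hfar : ∀ x : ℝ, (r : ℝ) < |x| → |u x| * ρ x < ε / 2 := by
      intro x hx
      have hx' : dist (u x * ρ x) 0 < ε / 2 := by
        rcases le_total 0 x with h0 | h0
        · rw [abs_of_nonneg h0] at hx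
          exact hb x (by linarith [le_abs_self b, le_max_left |b| |c|])
        · rw [abs_of_nonpos h0] at hx
          exact hc x (by linarith [neg_abs_le c, le_max_right |b| |c|])
      rwa [dist_zero_right, norm_mul, Real.norm_of_nonneg (hρ.pos x).le] at hx'
    obtain ⟨C, hC⟩ := hρ.exists_bound (r + 1)
    have hC0 : 0 < C := (hρ.pos 0).trans_le
      (hC 0 ⟨by linarith [Nat.cast_nonneg (α := ℝ) r], by positivity⟩)
    have hnear : ∀ᶠ v : C(ℝ, ℝ) in 𝓝 ⟨u, huc⟩, ∀ x ∈ Icc (-((r : ℝ) + 1)) (r + 1),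
        dist (u x) (v x) < ε / 2 / C :=
      Metric.tendstoUniformlyOn_iff.1
        (ContinuousMap.tendsto_iff_forall_isCompact_tendstoUniformlyOn.1 tendsto_id _ isCompact_Icc)
        _ (by positivity)
    obtain ⟨i, hi⟩ := (TopologicalSpace.denseRange_denseSeq C(ℝ, ℝ)).exists_mem_open
      isOpen_interior ⟨_, mem_interior_iff_mem_nhds.2 hnear⟩
    have hi' : ∀ x ∈ Icc (-((r : ℝ) + 1)) (r + 1), dist (u x) (h i x) < ε / 2 / C :=
      interior_subset hi
    refine ⟨Nat.pair (Nat.pair i r) K, Nat.right_le_pair _ _, fun x => ?_⟩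
    simp only [Nat.unpair_pair]
    have h0 := cutoff_nonneg r x
    have h1 := cutoff_le_one r x
    have hρx := (hρ.pos x).le
    -- The error splits as `cutoff * (h - u) - (1 - cutoff) * u`: the first part is small by uniform
    -- approximation, the second by decay of `u`.
    have hfirst : cutoff r x * (|h i x - u x| * ρ x) ≤ ε / 2 := by
      rcases le_or_gt |x| (r + 1) with hx | hx
      · have hx' := abs_le.1 hx
        have h2 := hi' x hx'
        rw [dist_comm, Real.dist_eq] at h2
        have h3 : |h i x - u x| * ρ x ≤ ε / 2 / C * C :=
          mul_le_mul h2.le (hC x hx') hρx (by positivity)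
        rw [div_mul_cancel₀ _ hC0.ne'] at h3
        exact (mul_le_of_le_one_left (by positivity) h1).trans h3
      · rw [cutoff_eq_zero hx, zero_mul]
        positivity
    have hsecond : (1 - cutoff r x) * (|u x| * ρ x) ≤ ε / 2 := by
      rcases le_or_gt |x| r with hx | hx
      · rw [cutoff_eq_one hx, sub_self, zero_mul]
        positivity
      · exact (mul_le_of_le_one_left (by positivity) (by linarith)).trans (hfar x hx).le
    calc |cutoff r x * h i x - u x| * ρ x
        = |cutoff r x * (h i x - u x) - (1 - cutoff r x) * u x| * ρ x := by ring_nf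
      _ ≤ (|cutoff r x * (h i x - u x)| + |(1 - cutoff r x) * u x|) * ρ x := by
        gcongr; exact abs_sub _ _
      _ = cutoff r x * (|h i x - u x| * ρ x) + (1 - cutoff r x) * (|u x| * ρ x) := by
        rw [abs_mul, abs_mul, abs_of_nonneg h0, abs_of_nonneg (sub_nonneg.2 h1)]
        ring
      _ ≤ ε := by linarith

theorem exists_bound_of_support {g : ℝ → ℝ} (hg : Continuous g) {R : ℝ}
    (hsupp : ∀ x, R < |x| → g x = 0) : ∃ B, ∀ x, |g x| ≤ B := by
  obtain ⟨B, hB⟩ := (isCompact_Icc (a := -R) (b := R)).exists_bound_of_continuousOn hg.continuousOn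
  refine ⟨max B 0, fun x => ?_⟩
  rcases le_or_gt |x| R with hx | hx
  · exact (hB x (abs_le.1 hx)).trans (le_max_left _ _)
  · rw [hsupp x hx, abs_zero]
    exact le_max_right _ _

/-- Short translations move a compactly supported continuous function little in the weighted
supremum norm. -/
theorem exists_translation_small {ρ : ℝ → ℝ} (hρ : IsAdmissibleWeight ρ) {g : ℝ → ℝ}
    (hg : Continuous g) {R : ℝ} (hsupp : ∀ x, R < |x| → g x = 0) {ε : ℝ} (hε : 0 < ε) :
    ∃ η : ℝ, 0 < η ∧ η ≤ 1 ∧ ∀ s, 0 ≤ s → s < η → ∀ x, |g (x + s) - g x| * ρ x ≤ ε := by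
  have hcs : HasCompactSupport g := HasCompactSupport.intro (isCompact_Icc (a := -R) (b := R))
    fun x hx => hsupp x (by
      by_contra! h
      exact hx (abs_le.1 h))
  have huc := hg.uniformContinuous_of_tendsto_cocompact hcs.is_zero_at_infty
  obtain ⟨C, hC⟩ := hρ.exists_bound (|R| + 1)
  have hC0 : 0 < C := (hρ.pos 0).trans_le (hC 0 ⟨by linarith [abs_nonneg R], by positivity⟩)
  obtain ⟨δ, hδ, h⟩ := Metric.uniformContinuous_iff.1 huc (ε / C) (by positivity)
  refine ⟨min δ 1, lt_min hδ one_pos, min_le_right _ _, fun s hs0 hs x => ?_⟩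
  have hs1 := hs.trans_le (min_le_right _ _)
  rcases le_or_gt |x| (|R| + 1) with hx | hx
  · have h1 : dist (g (x + s)) (g x) < ε / C := h (by
      rw [Real.dist_eq, add_sub_cancel_left, abs_of_nonneg hs0]
      exact hs.trans_le (min_le_left _ _))
    rw [Real.dist_eq] at h1
    have h2 := mul_le_mul h1.le (hC x (abs_le.1 hx)) (hρ.pos x).le (by positivity)
    rwa [div_mul_cancel₀ _ hC0.ne'] at h2
  · have hR := le_abs_self R
    have h1 : R < |x + s| := by
      have h2 := abs_sub_abs_le_abs_sub x (x + s)
      rw [sub_add_cancel_left, abs_neg, abs_of_nonneg hs0] at h2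
      linarith
    rw [hsupp _ h1, hsupp x (by linarith), sub_zero, abs_zero, zero_mul]
    exact hε.le

/-- For `t` in `[n, n + η)` with `n ∈ E (φ k)`, three errors of at most `ε / 4` add up: gluing, the
short translation `t - n`, and the distance of `g k` from the target. The gluing error is `1 / (k +
1)` times a factor `D` for the shifted weight, so `k` must be large; this is why each target needs
infinitely many approximants. -/
theorem DensityConditions.frequentlyHypercyclic {ρ : ℝ → ℝ} {hρ : IsAdmissibleWeight ρ}
    (hsup : BddAbove (Set.range fun k : ℤ => ρ ((k : ℝ) + 1) / ρ (k : ℝ))) {M : ℕ → ℝ}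
    (hM : ∀ p, 1 ≤ p → 0 < M p) (hMt : Tendsto M atTop atTop) {E : ℕ → Set ℕ}
    (hE : DensityConditions ρ M E) : FrequentlyHypercyclic (C0Weighted.translation hρ) := by
  obtain ⟨D, hD, hcomp⟩ := hρ.exists_comparison hsup
  obtain ⟨g, R, hg, hsupp, hdense⟩ := exists_dense_compactly_supported hρ
  choose B hB using fun k => exists_bound_of_support (hg k) (hsupp k)
  obtain ⟨φ, hφ, f, hf, happrox⟩ := hE.exists_approximating hρ hD hcomp hM hMt hg hsupp hB
  refine ⟨C0Weighted.mk hρ f hf, fun U hU ⟨u, hu⟩ => ?_⟩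
  obtain ⟨ε, hε, hball⟩ := Metric.isOpen_iff.1 hU u hu
  obtain ⟨K, hK⟩ := exists_nat_ge (D / (ε / 4))
  obtain ⟨k, hkK, hk⟩ := hdense u u.coe_mem (ε / 4) (by positivity) K
  obtain ⟨η, hη, hη1, hs⟩ := exists_translation_small hρ (hg k) (hsupp k) (ε := ε / 4) (by positivity)
  have hDk : D * (1 / (k + 1)) ≤ ε / 4 := by
    have hkK' : (K : ℝ) ≤ k := by exact_mod_cast hkK
    rw [div_le_iff₀ (by positivity)] at hK
    rw [mul_one_div, div_le_iff₀ (by positivity)]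
    nlinarith
  refine lowerDensityReal_pos (hE.pos_density _ (hφ k)) hη hη1 fun n hn t hnt htn => hball ?_
  rw [mem_ball_iff_norm]
  refine lt_of_le_of_lt (ciSup_le fun x => ?_) (show 3 * (ε / 4) < ε by linarith)
  change |f (x + t) - u x| * ρ x ≤ _
  set s : ℝ := t - n
  have hs0 : 0 ≤ s := sub_nonneg.2 hnt
  have hsη : s < η := by simp only [s]; linarith
  have e1 := happrox k n hn (x + s)
  rw [show x + s + n = x + t by simp only [s]; ring] at e1
  have e2 := hs s hs0 hsη x
  have e3 := hk x
  have e4 : |f (x + t) - g k (x + s)| * ρ x ≤ ε / 4 := by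
    calc |f (x + t) - g k (x + s)| * ρ x ≤ |f (x + t) - g k (x + s)| * (D * ρ (x + s)) := by
          gcongr
          exact hcomp _ _ (by rw [sub_add_cancel_left, abs_neg, abs_of_nonneg hs0]; linarith)
      _ = D * (|f (x + t) - g k (x + s)| * ρ (x + s)) := by ring
      _ ≤ D * (1 / (k + 1)) := mul_le_mul_of_nonneg_left e1 (by linarith)
      _ ≤ ε / 4 := hDk
  have e5 : |f (x + t) - u x| ≤
      |f (x + t) - g k (x + s)| + |g k (x + s) - g k x| + |g k x - u x| :=
    (abs_sub_le _ (g k x) _).trans (by gcongr; exact abs_sub_le _ _ _)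
  have e6 := mul_le_mul_of_nonneg_right e5 (hρ.pos x).le
  linarith

theorem mainTheorem1 (ρ : ℝ → ℝ) (hρ : IsAdmissibleWeight ρ)
    (hsup : BddAbove (Set.range fun k : ℤ => ρ ((k : ℝ) + 1) / ρ (k : ℝ))) :
    (FrequentlyHypercyclic (C0Weighted.translation hρ) ↔
      ∃ M : ℕ → ℝ, (∀ p, 1 ≤ p → 0 < M p) ∧ Tendsto M atTop atTop ∧
        ∃ E : ℕ → Set ℕ, DensityConditions ρ M E) ∧
    (FrequentlyHypercyclic (C0Weighted.translation hρ) ↔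
      ∀ M : ℕ → ℝ, (∀ p, 1 ≤ p → 0 < M p) → Tendsto M atTop atTop →
        ∃ E : ℕ → Set ℕ, DensityConditions ρ M E) := by
  have hcast : ∀ p : ℕ, 1 ≤ p → (0 : ℝ) < p := fun p hp => by exact_mod_cast hp
  -- The sequence `M p = p` serves both as witness for existence and as test sequence for the
  -- universal condition.
  refine ⟨⟨fun h => ⟨fun p => p, hcast, tendsto_natCast_atTop_atTop,
    h.exists_densityConditions hsup hcast⟩, ?_⟩, ⟨fun h M hM _ =>
    h.exists_densityConditions hsup hM, fun h => ?_⟩⟩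
  · rintro ⟨M, hM, hMt, E, hE⟩
    exact hE.frequentlyHypercyclic hsup hM hMt
  · obtain ⟨E, hE⟩ := h (fun p => p) hcast tendsto_natCast_atTop_atTop
    exact hE.frequentlyHypercyclic hsup hcast tendsto_natCast_atTop_atTop
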